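/- Let $\mathbb{F}$ be an infinite field of arbitrary characteristic. Let $\mathsf{A}_1=\mathbb{F}\langle x,y\rangle/(yx-xy-1)$ be the first Weyl algebra, $\mathsf{V}=\mathbb{F}\text{-span}\{x,y\}\subset\mathsf{A}_1$, and let $\mathbb{F}\langle X\rangle$ be the free unital associative $\mathbb{F}$-algebra on the letters $x_1,x_2,\dots$. An element $f(x_1,\dots,x_m)\in\mathbb{F}\langle X\rangle$ is called a weak polynomial identity for the pair $(\mathsf{A}_1,\mathsf{V})$ if $f(a_1,\dots,a_m)=0$ in $\mathsf{A}_1$ for all $a_1,\dots,a_m\in\mathsf{V}$. With $[a,b]=ab-ba$, put $$\Gamma_3(x_1,x_2,x_3)=[[x_1,x_2],x_3],\qquad \mathrm{St}_3(x_1,x_2,x_3)=x_1[x_2,x_3]-x_2[x_1,x_3]+x_3[x_1,x_2],$$ $$T_4(x_1,x_2,x_3,x_4)=[x_1,x_2][x_3,x_4]-[x_1,x_3][x_2,x_4]+[x_2,x_3][x_1,x_4].$$ Let $\mathcal{I}$ be the L-ideal of $\mathbb{F}\langle X\rangle$ generated by $\Gamma_3$, $\mathrm{St}_3$ and $T_4$,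 that is, the $\mathbb{F}$-span of all elements $u\,h(g_1,\dots,g_m)\,v$, where $h\in\{\Gamma_3,\mathrm{St}_3,T_4\}$ has $m$ variables, $u,v\in\mathbb{F}\langle X\rangle$, and $g_1,\dots,g_m$ are $\mathbb{F}$-linear combinations of letters. Then every weak polynomial identity for $(\mathsf{A}_1,\mathsf{V})$ in two variables lies in $\mathcal{I}$: if $i,j\ge 1$ and $f\in\mathbb{F}\langle x_i,x_j\rangle\subset\mathbb{F}\langle X\rangle$ is a weak polynomial identity for $(\mathsf{A}_1,\mathsf{V})$, then $f\in\mathcal{I}$. -/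

import Mathlib

namespace WeakIdentities

/-- The relation `y * x ∼ x * y + 1` on the free unital algebra on two letters
`x = ι 0` and `y = ι 1`. -/
inductive WeylRel (F : Type*) [Field F] :
    FreeAlgebra F (Fin 2) → FreeAlgebra F (Fin 2) → Prop
  | mk : WeylRel F (FreeAlgebra.ι F 1 * FreeAlgebra.ι F 0)
      (FreeAlgebra.ι F 0 * FreeAlgebra.ι F 1 + 1)

/-- The first Weyl algebra `F⟨x, y⟩ / (y x - x y - 1)`. -/
abbrev Weyl (F : Type*) [Field F] : Type _ := RingQuot (WeylRel F)

/-- The generator `x` of the Weyl algebra. -/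
noncomputable def Weyl.x (F : Type*) [Field F] : Weyl F :=
  RingQuot.mkAlgHom F (WeylRel F) (FreeAlgebra.ι F 0)

/-- The generator `y` of the Weyl algebra. -/
noncomputable def Weyl.y (F : Type*) [Field F] : Weyl F :=
  RingQuot.mkAlgHom F (WeylRel F) (FreeAlgebra.ι F 1)

/-- The subspace `V = span {x, y}` of the Weyl algebra. -/
noncomputable def Weyl.V (F : Type*) [Field F] : Submodule F (Weyl F) :=
  Submodule.span F {Weyl.x F, Weyl.y F}

theorem Weyl.y_mul_x (F : Type*) [Field F] :
    Weyl.y F * Weyl.x F = Weyl.x F * Weyl.y F + 1 := by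
  simpa [Weyl.x, Weyl.y] using RingQuot.mkAlgHom_rel F (WeylRel.mk (F := F))

/-- `V` generates the Weyl algebra: every element is a noncommutative polynomial without
free term in elements of `V`. So the identities of `V` are the weak identities of the pair
consisting of the Weyl algebra and `V`. -/
theorem Weyl.adjoin_V (F : Type*) [Field F] :
    NonUnitalAlgebra.adjoin F (Weyl.V F : Set (Weyl F)) = ⊤ := by
  set B := NonUnitalAlgebra.adjoin F (Weyl.V F : Set (Weyl F)) with hB
  have hx : Weyl.x F ∈ B :=
    NonUnitalAlgebra.subset_adjoin F (Submodule.subset_span (by simp))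
  have hy : Weyl.y F ∈ B :=
    NonUnitalAlgebra.subset_adjoin F (Submodule.subset_span (by simp))
  have h1 : (1 : Weyl F) ∈ B := by
    have h : (1 : Weyl F) = Weyl.y F * Weyl.x F - Weyl.x F * Weyl.y F := by
      rw [Weyl.y_mul_x]; abel
    rw [h]
    exact sub_mem (mul_mem hy hx) (mul_mem hx hy)
  rw [eq_top_iff]
  rintro a -
  obtain ⟨p, rfl⟩ := RingQuot.mkAlgHom_surjective F (WeylRel F) a
  induction p using FreeAlgebra.induction with
  | grade0 r =>
    rw [AlgHom.commutes, Algebra.algebraMap_eq_smul_one]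
    exact B.smul_mem r h1
  | grade1 i =>
    fin_cases i
    · exact hx
    · exact hy
  | mul p q hp hq => rw [map_mul]; exact mul_mem hp hq
  | add p q hp hq => rw [map_add]; exact add_mem hp hq

/-- The free unital algebra `F⟨X⟩` on countably many letters; the letters are
`ι 0, ι 1, ι 2, …`. -/
abbrev FreeAlg (F : Type*) [Field F] : Type _ := FreeAlgebra F ℕ

/-- `f` is a polynomial identity for the subspace `V` of the unital algebra `A`: it vanishes
whenever elements of `V` are substituted for its letters. -/
def IsIdentityOn {F : Type*} [Field F] {A : Type*} [Ring A] [Algebra F A]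
    (V : Submodule F A) (f : FreeAlg F) : Prop :=
  ∀ a : ℕ → A, (∀ k, a k ∈ V) → FreeAlgebra.lift F a f = 0

/-- The L-ideal generated by a set `S`: the linear span of all `u * s(g₀, g₁, …) * v` with
`s ∈ S`, `u v` arbitrary, and every `g k` a linear combination of letters. -/
def LIdealSpan {F : Type*} [Field F] (S : Set (FreeAlg F)) : Submodule F (FreeAlg F) :=
  Submodule.span F {h | ∃ s ∈ S, ∃ g : ℕ → FreeAlg F,
    (∀ k, g k ∈ Submodule.span F (Set.range (FreeAlgebra.ι F : ℕ → FreeAlg F))) ∧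
      ∃ u v : FreeAlg F, h = u * FreeAlgebra.lift F g s * v}

/-- `[[a, b], c]`, where `⁅a, b⁆ = a * b - b * a`. -/
def gamma3 {R : Type*} [Ring R] (a b c : R) : R := ⁅⁅a, b⁆, c⁆

/-- `a [b, c] - b [a, c] + c [a, b]`. -/
def st3 {R : Type*} [Ring R] (a b c : R) : R := a * ⁅b, c⁆ - b * ⁅a, c⁆ + c * ⁅a, b⁆

/-- `[a, b] [c, d] - [a, c] [b, d] + [b, c] [a, d]`. -/
def t4 {R : Type*} [Ring R] (a b c d : R) : R :=
  ⁅a, b⁆ * ⁅c, d⁆ - ⁅a, c⁆ * ⁅b, d⁆ + ⁅b, c⁆ * ⁅a, d⁆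

/-- The L-ideal generated by the elements `Γ₃`, `St₃` and `T₄` of `F⟨X⟩`. -/
noncomputable def idealI (F : Type*) [Field F] : Submodule F (FreeAlg F) :=
  LIdealSpan {gamma3 (FreeAlgebra.ι F 0) (FreeAlgebra.ι F 1) (FreeAlgebra.ι F 2),
    st3 (FreeAlgebra.ι F 0) (FreeAlgebra.ι F 1) (FreeAlgebra.ι F 2),
    t4 (FreeAlgebra.ι F 0) (FreeAlgebra.ι F 1) (FreeAlgebra.ι F 2) (FreeAlgebra.ι F 3)}

end WeakIdentities

/-!
The commutator of two elements of `V` is a scalar, so `Γ₃` is a weak identity. Modulo the L-ideal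
`I` generated by `Γ₃`, the element `c = [x_i, x_j]` commutes with `x_i` and `x_j`, so `f` is
congruent to a linear combination of the normal monomials `x_i ^ p x_j ^ q c ^ r`. As `I` consists
of weak identities, that combination is again a weak identity. Under `x_i ↦ s x`, `x_j ↦ y` the
normal monomial becomes `(-1) ^ r s ^ (p + r) x ^ p y ^ q`; since the `x ^ p y ^ q` are linearly
independent in the Weyl algebra and `s` ranges over an infinite field, all its coefficients vanish.
-/

namespace WeakIdentities

open Polynomial

section Commutators

variable {R S G : Type*} [Ring R] [Ring S] [FunLike G R S]

theorem map_ringLie [NonUnitalRingHomClass G R S] (φ : G) (a b : R) : φ ⁅a, b⁆ = ⁅φ a, φ b⁆ := by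
  simp only [Ring.lie_def, map_sub, map_mul]

theorem map_gamma3 [NonUnitalRingHomClass G R S] (φ : G) (a b c : R) :
    φ (gamma3 a b c) = gamma3 (φ a) (φ b) (φ c) := by
  simp only [gamma3, map_ringLie]

theorem gamma3_eq_zero_iff_commute {a b c : R} : gamma3 a b c = 0 ↔ Commute ⁅a, b⁆ c :=
  commute_iff_lie_eq.symm

/-- The normal monomial `a ^ p b ^ q [a, b] ^ r` with exponents `n = (p, q, r)`. When `[a, b]`
commutes with `a` and `b`, these monomials span the algebra generated by `a` and `b`. -/
def normalMonomial (a b : R) (n : ℕ × ℕ × ℕ) : R := a ^ n.1 * b ^ n.2.1 * ⁅a, b⁆ ^ n.2.2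

theorem map_normalMonomial [RingHomClass G R S] (φ : G) (a b : R) (n : ℕ × ℕ × ℕ) :
    φ (normalMonomial a b n) = normalMonomial (φ a) (φ b) n := by
  simp only [normalMonomial, map_mul, map_pow, map_ringLie]

theorem normalMonomial_apply {σ : Type*} (a b : σ → R) (n : ℕ × ℕ × ℕ) (s : σ) :
    normalMonomial a b n s = normalMonomial (a s) (b s) n :=
  map_normalMonomial (Pi.evalRingHom (fun _ ↦ R) s) a b n

theorem left_mul_normalMonomial (a b : R) (p q r : ℕ) :
    a * normalMonomial a b (p, q, r) = normalMonomial a b (p + 1, q, r) := by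
  simp only [normalMonomial, pow_succ', mul_assoc]

variable {a b : R}

/-- At `p = 0` the truncated exponent `p - 1` comes with the coefficient `0`. -/
theorem right_mul_pow_left (hca : Commute ⁅a, b⁆ a) (p : ℕ) :
    b * a ^ p = a ^ p * b - p • (a ^ (p - 1) * ⁅a, b⁆) := by
  induction p with
  | zero => simp
  | succ p ih =>
    have hba : b * a = a * b - ⁅a, b⁆ := by rw [Ring.lie_def, sub_sub_cancel]
    have hshift : p • (a ^ (p - 1) * ⁅a, b⁆) * a = p • (a ^ p * ⁅a, b⁆) := by
      cases p with
      | zero => simp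
      | succ p => rw [smul_mul_assoc, mul_assoc, hca.eq, ← mul_assoc, Nat.add_sub_cancel, pow_succ]
    calc b * a ^ (p + 1) = a ^ p * (b * a) - p • (a ^ (p - 1) * ⁅a, b⁆) * a := by
          rw [pow_succ, ← mul_assoc, ih, sub_mul, mul_assoc]
      _ = a ^ (p + 1) * b - (p + 1) • (a ^ p * ⁅a, b⁆) := by
          rw [hba, hshift, succ_nsmul', mul_sub, ← mul_assoc, ← pow_succ, sub_sub]

theorem right_mul_normalMonomial (hca : Commute ⁅a, b⁆ a) (hcb : Commute ⁅a, b⁆ b) (p q r : ℕ) :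
    b * normalMonomial a b (p, q, r) =
      normalMonomial a b (p, q + 1, r) - p • normalMonomial a b (p - 1, q, r + 1) := by
  have hc : ⁅a, b⁆ * (b ^ q * ⁅a, b⁆ ^ r) = b ^ q * ⁅a, b⁆ ^ (r + 1) := by
    rw [← mul_assoc, (hcb.pow_right q).eq, mul_assoc, pow_succ']
  simp only [normalMonomial, mul_assoc]
  rw [← mul_assoc, right_mul_pow_left hca, sub_mul, smul_mul_assoc, mul_assoc, mul_assoc, hc,
    pow_succ' b, mul_assoc b]

end Commutators

section Spanning

theorem toSubmodule_adjoin_le_of_mul_mem {R A : Type*} [CommSemiring R] [Semiring A] [Algebra R A]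
    {s : Set A} {M : Submodule R A} (one_mem : 1 ∈ M) (mul_mem : ∀ a ∈ s, ∀ m ∈ M, a * m ∈ M) :
    Subalgebra.toSubmodule (Algebra.adjoin R s) ≤ M := by
  rw [Algebra.adjoin_eq_span, Submodule.span_le]
  intro w hw
  induction hw using Submonoid.closure_induction_left with
  | one => exact one_mem
  | mul_left a ha m _ hm => exact mul_mem a ha m hm

variable {R A : Type*} [CommRing R] [Ring A] [Algebra R A]

theorem lie_smul_add_smul (α β γ δ : R) (a b : A) :
    ⁅α • a + β • b, γ • a + δ • b⁆ = (α * δ - β * γ) • ⁅a, b⁆ := by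
  simp only [Ring.lie_def, add_mul, mul_add, smul_mul_assoc, mul_smul_comm]
  module

theorem toSubmodule_adjoin_pair_le_span_normalMonomial {a b : A} (hca : Commute ⁅a, b⁆ a)
    (hcb : Commute ⁅a, b⁆ b) :
    Subalgebra.toSubmodule (Algebra.adjoin R {a, b}) ≤
      Submodule.span R (Set.range (normalMonomial a b)) := by
  set M := Submodule.span R (Set.range (normalMonomial a b))
  have monomial_mem (n) : normalMonomial a b n ∈ M := Submodule.subset_span ⟨n, rfl⟩
  have mul_mem_of_monomial {d : A} (h : ∀ n, d * normalMonomial a b n ∈ M) :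
      ∀ m ∈ M, d * m ∈ M :=
    have hle : M ≤ M.comap (LinearMap.mulLeft R d) :=
      Submodule.span_le.mpr (Set.range_subset_iff.mpr h)
    fun _ hm ↦ hle hm
  refine toSubmodule_adjoin_le_of_mul_mem ?_ ?_
  · simpa [normalMonomial] using monomial_mem (0, 0, 0)
  · rintro d (rfl | rfl) <;> refine mul_mem_of_monomial fun ⟨p, q, r⟩ ↦ ?_
    · exact left_mul_normalMonomial d b p q r ▸ monomial_mem _
    · rw [right_mul_normalMonomial hca hcb]
      exact sub_mem (monomial_mem _) (M.nsmul_mem (monomial_mem _) p)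

theorem exists_sub_linearCombination_normalMonomial_mem {a b : A} {J : TwoSidedIdeal A}
    (ha : gamma3 a b a ∈ J) (hb : gamma3 a b b ∈ J) {f : A} (hf : f ∈ Algebra.adjoin R {a, b}) :
    ∃ P, f - Finsupp.linearCombination R (normalMonomial a b) P ∈ J := by
  let π := J.ringCon.mkₐ R
  have π_eq_iff (g h : A) : π g = π h ↔ g - h ∈ J := J.ringCon.eq.trans (J.rel_iff g h)
  have commute_of_mem {d : A} (hd : gamma3 a b d ∈ J) : Commute ⁅π a, π b⁆ (π d) := by
    rw [← gamma3_eq_zero_iff_commute, ← map_gamma3, ← map_zero π, π_eq_iff, sub_zero]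
    exact hd
  have hπf : π f ∈ Algebra.adjoin R {π a, π b} := by
    rw [← Set.image_pair, ← AlgHom.map_adjoin]
    exact ⟨f, hf, rfl⟩
  have hspan := toSubmodule_adjoin_pair_le_span_normalMonomial (R := R)
    (commute_of_mem ha) (commute_of_mem hb) hπf
  obtain ⟨P, hP⟩ := (Finsupp.mem_span_range_iff_exists_finsupp).mp hspan
  refine ⟨P, (π_eq_iff _ _).mp ?_⟩
  simp only [← hP, Finsupp.linearCombination_apply, map_finsuppSum, map_smul, map_normalMonomial]

end Spanning

section Independence

theorem linearIndependent_pow_smul {R M ι : Type*} [CommRing R] [IsDomain R] [Infinite R]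
    [AddCommGroup M] [Module R M] {v : ι → M} (hv : LinearIndependent R v) :
    LinearIndependent R fun (n : ι × ℕ) (s : R) ↦ s ^ n.2 • v n.1 := by
  let Φ : (ι →₀ R[X]) →ₗ[R] R → M := LinearMap.pi fun s ↦
    Finsupp.linearCombination R v ∘ₗ Finsupp.mapRange.linearMap (leval s)
  have hΦ : LinearMap.ker Φ = ⊥ := by
    refine (Submodule.eq_bot_iff _).mpr fun g hg ↦ Finsupp.ext fun i ↦ ?_
    refine Polynomial.funext fun s ↦ ?_
    have hgs := linearIndependent_iff.mp hv _ (congrFun hg s)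
    simpa using DFunLike.congr_fun hgs i
  let b := Finsupp.basis fun _ : ι ↦ basisMonomials R
  have hΦb : (fun (n : ι × ℕ) (s : R) ↦ s ^ n.2 • v n.1) =
      (Φ ∘ b) ∘ (Equiv.sigmaEquivProd ι ℕ).symm := by
    ext n s
    simp [Φ, b]
  rw [hΦb]
  exact (b.linearIndependent.map' Φ hΦ).comp _ (Equiv.injective _)

variable (F : Type*) [Field F]

/-- The action of the Weyl algebra on `F[u][t]`: the generator `x` multiplies by `t`, and `y` acts
as `u + d/dt`. Unlike the usual action on `F[t]`, it is faithful in every characteristic. -/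
noncomputable def Weyl.rep : Weyl F →ₐ[F] Module.End F F[X][X] :=
  RingQuot.liftAlgHom F ⟨FreeAlgebra.lift F
    ![LinearMap.mulLeft F X, LinearMap.mulLeft F (C X) + derivative.restrictScalars F], by
      rintro _ _ ⟨⟩
      ext1 f
      simp only [map_mul, map_add, map_one, FreeAlgebra.lift_ι_apply, Matrix.cons_val_zero,
        Matrix.cons_val_one, Module.End.mul_apply, LinearMap.add_apply, Module.End.one_apply,
        LinearMap.mulLeft_apply, LinearMap.restrictScalars_apply, derivative_mul, derivative_X]
      ring⟩

theorem Weyl.rep_x (f : F[X][X]) : Weyl.rep F (Weyl.x F) f = X * f := by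
  simp [Weyl.rep, Weyl.x]

theorem Weyl.rep_y (f : F[X][X]) : Weyl.rep F (Weyl.y F) f = C X * f + derivative f := by
  simp [Weyl.rep, Weyl.y]

theorem Weyl.rep_x_pow (p : ℕ) (f : F[X][X]) : Weyl.rep F (Weyl.x F ^ p) f = X ^ p * f := by
  induction p with
  | zero => simp
  | succ p ih => rw [pow_succ', map_mul, Module.End.mul_apply, ih, Weyl.rep_x, pow_succ', mul_assoc]

theorem Weyl.rep_y_pow_one (q : ℕ) : Weyl.rep F (Weyl.y F ^ q) 1 = C (X ^ q) := by
  induction q with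
  | zero => simp
  | succ q ih =>
    rw [pow_succ', map_mul, Module.End.mul_apply, ih, Weyl.rep_y, derivative_C, add_zero, ← C_mul,
      pow_succ']

theorem Weyl.linearIndependent_x_pow_mul_y_pow :
    LinearIndependent F fun n : ℕ × ℕ ↦ Weyl.x F ^ n.1 * Weyl.y F ^ n.2 := by
  refine .of_comp ((LinearMap.applyₗ 1).comp (Weyl.rep F).toLinearMap) ?_
  convert ((basisMonomials F).smulTower' (basisMonomials F[X])).linearIndependent using 1
  ext1 n
  simp only [Function.comp_apply, LinearMap.comp_apply, AlgHom.toLinearMap_apply,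
    LinearMap.applyₗ_apply_apply, map_mul, Module.End.mul_apply, Weyl.rep_y_pow_one, Weyl.rep_x_pow,
    Module.Basis.smulTower'_apply, coe_basisMonomials, smul_monomial, smul_eq_mul, mul_one,
    X_pow_eq_monomial, monomial_mul_C, one_mul]

theorem Weyl.lie_x_y : ⁅Weyl.x F, Weyl.y F⁆ = -1 := by
  rw [Ring.lie_def, Weyl.y_mul_x, sub_add_cancel_left]

theorem Weyl.normalMonomial_smul_x_y (s : F) (p q r : ℕ) :
    normalMonomial (s • Weyl.x F) (Weyl.y F) (p, q, r) =
      (-1 : F) ^ r • s ^ (p + r) • (Weyl.x F ^ p * Weyl.y F ^ q) := by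
  have hlie : ⁅s • Weyl.x F, Weyl.y F⁆ = algebraMap F (Weyl F) (-s) := by
    rw [map_neg, Algebra.algebraMap_eq_smul_one]
    simpa [Weyl.lie_x_y] using
      lie_smul_add_smul s 0 0 1 (Weyl.x F) (Weyl.y F)
  calc normalMonomial (s • Weyl.x F) (Weyl.y F) (p, q, r)
      = (s ^ p * (-s) ^ r) • (Weyl.x F ^ p * Weyl.y F ^ q) := by
        simp only [normalMonomial]
        rw [hlie, _root_.smul_pow, smul_mul_assoc, ← map_pow, ← Algebra.commutes,
          ← Algebra.smul_def, smul_smul, mul_comm]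
    _ = (-1 : F) ^ r • s ^ (p + r) • (Weyl.x F ^ p * Weyl.y F ^ q) := by
        rw [smul_smul, neg_pow, pow_add]
        congr 1
        ring

/-- The functions `F → Weyl F` package the substitutions `(s x, y)`, `s : F`, into a single one. -/
theorem Weyl.linearIndependent_normalMonomial [Infinite F] :
    LinearIndependent F (normalMonomial (fun s : F ↦ s • Weyl.x F) fun _ ↦ Weyl.y F) := by
  let σ : ℕ × ℕ × ℕ → (ℕ × ℕ) × ℕ := fun n ↦ ((n.1, n.2.1), n.1 + n.2.2)
  have hσ : Function.Injective σ := by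
    rintro ⟨p, q, r⟩ ⟨p', q', r'⟩ h
    simp only [σ, Prod.mk.injEq] at h ⊢
    lia
  have hmonomial : normalMonomial (fun s : F ↦ s • Weyl.x F) (fun _ ↦ Weyl.y F) =
      (fun n : ℕ × ℕ × ℕ ↦ (-1 : Fˣ) ^ n.2.2) •
        (fun (n : (ℕ × ℕ) × ℕ) (s : F) ↦ s ^ n.2 • (Weyl.x F ^ n.1.1 * Weyl.y F ^ n.1.2)) ∘ σ := by
    ext ⟨p, q, r⟩ s
    exact (normalMonomial_apply ..).trans (Weyl.normalMonomial_smul_x_y F s p q r)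
  rw [hmonomial]
  exact ((linearIndependent_pow_smul (Weyl.linearIndependent_x_pow_mul_y_pow F)).comp σ
    hσ).units_smul _

end Independence

section Identities

theorem algHom_lift_apply {R A B ι : Type*} [CommSemiring R] [Semiring A] [Algebra R A]
    [Semiring B] [Algebra R B] (φ : A →ₐ[R] B) (a : ι → A) (f : FreeAlgebra R ι) :
    φ (FreeAlgebra.lift R a f) = FreeAlgebra.lift R (fun k ↦ φ (a k)) f := by
  have h : φ.comp (FreeAlgebra.lift R a) = FreeAlgebra.lift R fun k ↦ φ (a k) := by
    ext k
    simp
  exact DFunLike.congr_fun h f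

variable {F A : Type*} [Field F] [Ring A] [Algebra F A]

theorem IsIdentityOn.lift_pi_eq_zero {V : Submodule F A} {f : FreeAlg F} (hf : IsIdentityOn V f)
    {σ : Type*} {a : ℕ → σ → A} (ha : ∀ k s, a k s ∈ V) : FreeAlgebra.lift F a f = 0 := by
  funext s
  exact (algHom_lift_apply (Pi.evalAlgHom F (fun _ ↦ A) s) a f).trans (hf _ fun k ↦ ha k s)

theorem isIdentityOn_of_mem_LIdealSpan {V : Submodule F A} {S : Set (FreeAlg F)}
    (hS : ∀ s ∈ S, IsIdentityOn V s) {f : FreeAlg F} (hf : f ∈ LIdealSpan S) :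
    IsIdentityOn V f := by
  intro a ha
  suffices LIdealSpan S ≤ LinearMap.ker (FreeAlgebra.lift F a).toLinearMap from this hf
  refine Submodule.span_le.mpr ?_
  rintro _ ⟨s, hs, g, hg, u, v, rfl⟩
  have letters_le : Submodule.span F (Set.range (FreeAlgebra.ι F)) ≤
      V.comap (FreeAlgebra.lift F a).toLinearMap := by
    refine Submodule.span_le.mpr (Set.range_subset_iff.mpr fun k ↦ ?_)
    simpa using ha k
  have hgs : FreeAlgebra.lift F a (FreeAlgebra.lift F g s) = 0 :=
    (algHom_lift_apply _ g s).trans (hS s hs _ fun k ↦ letters_le (hg k))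
  simp [hgs]

theorem Weyl.lie_mem_range_algebraMap {a b : Weyl F} (ha : a ∈ Weyl.V F) (hb : b ∈ Weyl.V F) :
    ⁅a, b⁆ ∈ Set.range (algebraMap F (Weyl F)) := by
  obtain ⟨α, β, rfl⟩ := Submodule.mem_span_pair.mp ha
  obtain ⟨γ, δ, rfl⟩ := Submodule.mem_span_pair.mp hb
  refine ⟨-(α * δ - β * γ), ?_⟩
  rw [lie_smul_add_smul, Weyl.lie_x_y, smul_neg, map_neg, Algebra.algebraMap_eq_smul_one]

theorem Weyl.isIdentityOn_gamma3 (k l m : ℕ) :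
    IsIdentityOn (Weyl.V F)
      (gamma3 (FreeAlgebra.ι F k) (FreeAlgebra.ι F l) (FreeAlgebra.ι F m)) := by
  intro a ha
  obtain ⟨c, hc⟩ := Weyl.lie_mem_range_algebraMap (ha k) (ha l)
  rw [map_gamma3, gamma3_eq_zero_iff_commute]
  simp only [FreeAlgebra.lift_ι_apply, ← hc]
  exact Algebra.commutes c (a m)

end Identities

section LIdeals

variable {F : Type*} [Field F] {S T : Set (FreeAlg F)}

theorem LIdealSpan_mono (h : S ⊆ T) : LIdealSpan S ≤ LIdealSpan T :=
  Submodule.span_mono fun _ ⟨s, hs, hw⟩ ↦ ⟨s, h hs, hw⟩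

theorem mul_mul_mem_LIdealSpan (u v : FreeAlg F) {w : FreeAlg F} (hw : w ∈ LIdealSpan S) :
    u * w * v ∈ LIdealSpan S := by
  suffices LIdealSpan S ≤ (LIdealSpan S).comap (LinearMap.mulRight F v ∘ₗ LinearMap.mulLeft F u)
    from this hw
  refine Submodule.span_le.mpr ?_
  rintro _ ⟨s, hs, g, hg, u', v', rfl⟩
  exact Submodule.subset_span ⟨s, hs, g, hg, u * u', v' * v, by simp [mul_assoc]⟩

variable (S) in
/-- The L-ideal generated by `S`, bundled as a two-sided ideal so that it has a quotient ring. -/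
def LIdeal : TwoSidedIdeal (FreeAlg F) :=
  .mk' (LIdealSpan S) (zero_mem _) add_mem neg_mem
    (fun {u _} hw ↦ by simpa using mul_mul_mem_LIdealSpan u 1 hw)
    (fun {_ v} hw ↦ by simpa using mul_mul_mem_LIdealSpan 1 v hw)

theorem mem_LIdeal {w : FreeAlg F} : w ∈ LIdeal S ↔ w ∈ LIdealSpan S :=
  TwoSidedIdeal.mem_mk' ..

theorem gamma3_mem_LIdealSpan
    (k l m : ℕ) :
    gamma3 (FreeAlgebra.ι F k) (FreeAlgebra.ι F l) (FreeAlgebra.ι F m) ∈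
      LIdealSpan {gamma3 (FreeAlgebra.ι F 0) (FreeAlgebra.ι F 1) (FreeAlgebra.ι F 2)} := by
  let g : ℕ → ℕ
    | 0 => k
    | 1 => l
    | _ => m
  refine Submodule.subset_span ⟨_, rfl, fun n ↦ FreeAlgebra.ι F (g n),
    fun n ↦ Submodule.subset_span ⟨g n, rfl⟩, 1, 1, ?_⟩
  simp [map_gamma3, g]

end LIdeals

section TwoLetters

variable {F : Type*} [Field F] [Infinite F] {i j : ℕ}

theorem eq_zero_of_isIdentityOn_linearCombination_normalMonomial (hij : i ≠ j)
    {P : ℕ × ℕ × ℕ →₀ F}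
    (hP : IsIdentityOn (Weyl.V F) (Finsupp.linearCombination F
      (normalMonomial (FreeAlgebra.ι F i) (FreeAlgebra.ι F j)) P)) : P = 0 := by
  let a : ℕ → F → Weyl F := fun k s ↦ if k = i then s • Weyl.x F else Weyl.y F
  have ha (k : ℕ) (s : F) : a k s ∈ Weyl.V F := by
    dsimp only [a]
    split_ifs
    · exact Submodule.smul_mem _ s (Submodule.subset_span (by simp))
    · exact Submodule.subset_span (by simp)
  have hai : a i = fun s ↦ s • Weyl.x F := by simp [a]
  have haj : a j = fun _ ↦ Weyl.y F := by simp [a, hij.symm]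
  refine linearIndependent_iff.mp (Weyl.linearIndependent_normalMonomial F) P ?_
  rw [← hP.lift_pi_eq_zero ha, ← hai, ← haj]
  simp only [Finsupp.linearCombination_apply, map_finsuppSum, map_smul, map_normalMonomial,
    FreeAlgebra.lift_ι_apply]

theorem mem_LIdealSpan_gamma3_of_isIdentityOn (hij : i ≠ j) {f : FreeAlg F}
    (hf : f ∈ Algebra.adjoin F {FreeAlgebra.ι F i, FreeAlgebra.ι F j})
    (hid : IsIdentityOn (Weyl.V F) f) :
    f ∈ LIdealSpan {gamma3 (FreeAlgebra.ι F 0) (FreeAlgebra.ι F 1) (FreeAlgebra.ι F 2)} := by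
  obtain ⟨P, hP⟩ := exists_sub_linearCombination_normalMonomial_mem
    (mem_LIdeal.mpr (gamma3_mem_LIdealSpan i j i))
    (mem_LIdeal.mpr (gamma3_mem_LIdealSpan i j j)) hf
  rw [mem_LIdeal] at hP
  have hdiff := isIdentityOn_of_mem_LIdealSpan (V := Weyl.V F)
    (by rintro _ rfl; exact Weyl.isIdentityOn_gamma3 0 1 2) hP
  have hP0 : P = 0 := eq_zero_of_isIdentityOn_linearCombination_normalMonomial hij fun a ha ↦ by
    simpa [hid a ha] using hdiff a ha
  simpa [hP0] using hP

end TwoLetters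

end WeakIdentities

open WeakIdentities in
theorem mainTheorem1_general (F : Type*) [Field F] [Infinite F] (i j : ℕ) (f : FreeAlg F)
    (hf : f ∈ Algebra.adjoin F {FreeAlgebra.ι F i, FreeAlgebra.ι F j})
    (hid : IsIdentityOn (Weyl.V F) f) :
    f ∈ LIdealSpan {gamma3 (FreeAlgebra.ι F 0) (FreeAlgebra.ι F 1) (FreeAlgebra.ι F 2)} := by
  obtain rfl | hij := eq_or_ne i j
  · have hf' : f ∈ Algebra.adjoin F {FreeAlgebra.ι F i, FreeAlgebra.ι F (i + 1)} :=
      Algebra.adjoin_mono (by simp) hf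
    exact mem_LIdealSpan_gamma3_of_isIdentityOn i.succ_ne_self.symm hf' hid
  · exact mem_LIdealSpan_gamma3_of_isIdentityOn hij hf hid

theorem mainTheorem1 (F : Type*) [Field F] [Infinite F] (i j : ℕ)
    (f : WeakIdentities.FreeAlg F)
    (hf : f ∈ Algebra.adjoin F
      ({FreeAlgebra.ι F i, FreeAlgebra.ι F j} : Set (WeakIdentities.FreeAlg F)))
    (hid : WeakIdentities.IsIdentityOn (WeakIdentities.Weyl.V F) f) :
    f ∈ WeakIdentities.idealI F :=
  WeakIdentities.LIdealSpan_mono (by simp) (mainTheorem1_general F i j f hf hid)
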